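/- **Setting.** Let $H$ be a real or complex Hilbert space and let $A : D(A)\subset H\to H$ be a densely defined, selfadjoint, positive definite linear operator with a compact inverse. Let $T>0$, $u^0\in H$ and $f\in C([0,T];H)$, and consider $u'+Au=f$ on $(0,T)$, $u(0)=u^0$. For integers $J\ge 2$ and $N_c\ge 1$ put $\Delta T=T/N_c$, $\Delta t=\Delta T/J$, $T_n=n\Delta T$, $t_n=n\Delta t$. Real functions of $A$ are defined through its spectral decomposition. The four-stage Lobatto IIIC method has the Butcher tableau $$a=\begin{pmatrix}\frac1{12}&-\frac{\sqrt5}{12}&\frac{\sqrt5}{12}&-\frac1{12}\\ \frac1{12}&\frac14&\frac{10-7\sqrt5}{60}&\frac{\sqrt5}{60}\\ \frac1{12}&\frac{10+7\sqrt5}{60}&\frac14&-\frac{\sqrt5}{60}\\ \frac1{12}&\frac5{12}&\frac5{12}&\frac1{12}\end{pmatrix},\quad b=\Big(\tfrac1{12},\tfrac5{12},\tfrac5{12},\tfrac1{12}\Big)^\top,\quad c=\Big(0,\ \tfrac12-\tfrac{\sqrt5}{10},\ \tfrac12+\tfrac{\sqrt5}{10},\ 1\Big)^\top .$$ Let $r(z)=1+z\,b^\top(I-za)^{-1}\mathbb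 1$ be its stability function and $(p_1(z),\dots,p_4(z))=b^\top(I-za)^{-1}$. The fine and coarse propagators are $$\mathcal F(t,v)=r(-\Delta t A)v+\Delta t\sum_{i=1}^4 p_i(-\Delta t A)f(t+c_i\Delta t),\qquad \mathcal G(t,v)=(I+\Delta T A)^{-1}\big(v+\Delta T f(t)\big).$$ The time stepping solution is $u^{n+1}=\mathcal F(t_n,u^n)$ for $0\le n<JN_c$, starting from the given $u^0$. The parareal iterates $U_k^n$ ($k\ge0$, $0\le n\le N_c$) are defined by $U_k^0=u^0$ for all $k$, by $U_0^{n+1}=\mathcal G(T_n,U_0^n)$, and by $$U_{k+1}^{n+1}=\mathcal G(T_n,U_{k+1}^n)+\widetilde U^{n,J}-\mathcal G(T_n,U_k^n),\qquad \widetilde U^{n,0}=U_k^n,\quad \widetilde U^{n,j+1}=\mathcal F(T_n+j\Delta t,\widetilde U^{n,j})\ \ (0\le j<J).$$ **Proposition 4.4.** For the four-stage Lobatto IIIC method, $$r(-s)=\frac{12s^2-120s+360}{s^4+12s^3+72s^2+240s+360}\qquad\text{for all } s\ge 0,$$ and the parareal iteration converges linearly with factor $0.31$ for every $J\ge2$: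 there is a constant $c$, depending only on $T$ and on upper bounds for $\|u^0\|$ and $\max_{[0,T]}\|f\|$ (and not on $H$, $A$, $J$, $N_c$ or $k$), such that for all $J\ge2$, $N_c\ge1$ and $k\ge0$ $$\max_{1\le n\le N_c}\|U_k^n-u^{nJ}\|\le c\,\gamma^k\quad\text{with}\quad\gamma=0.31 .$$ -/

import Mathlib

noncomputable section

/-- The Butcher tableau of an `m`-stage Runge--Kutta method: coefficient matrix `a`,
weights `b` and nodes `c`. -/
structure ButcherTableau (m : ℕ) where
  a : Matrix (Fin m) (Fin m) ℝ
  b : Fin m → ℝ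
  c : Fin m → ℝ

namespace ButcherTableau

variable {m : ℕ}

/-- The stability function `r(z) = 1 + z bᵀ (I - z a)⁻¹ 𝟙`. -/
def stab (B : ButcherTableau m) (z : ℝ) : ℝ :=
  1 + z * (B.b ⬝ᵥ ((1 - z • B.a)⁻¹.mulVec (fun _ => 1)))

/-- The rational functions `pᵢ(z)`, the entries of the row vector `bᵀ (I - z a)⁻¹`. They are the
ones for which one Runge--Kutta step for `u' = -A u + f` reads
`r(-Δt A) u + Δt ∑ᵢ pᵢ(-Δt A) f(t + cᵢ Δt)`. -/
def src (B : ButcherTableau m) (i : Fin m) (z : ℝ) : ℝ :=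
  Matrix.vecMul B.b (1 - z • B.a)⁻¹ i

end ButcherTableau

/-- The four-stage Lobatto IIIC method. -/
def lobattoIIIC4 : ButcherTableau 4 where
  a := !![1 / 12, -√5 / 12, √5 / 12, -1 / 12;
          1 / 12, 1 / 4, (10 - 7 * √5) / 60, √5 / 60;
          1 / 12, (10 + 7 * √5) / 60, 1 / 4, -√5 / 60;
          1 / 12, 5 / 12, 5 / 12, 1 / 12]
  b := ![1 / 12, 5 / 12, 5 / 12, 1 / 12]
  c := ![0, 1 / 2 - √5 / 10, 1 / 2 + √5 / 10, 1]

section Operator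

variable {𝕜 H : Type*} [RCLike 𝕜] [NormedAddCommGroup H] [InnerProductSpace 𝕜 H] [CompleteSpace H]

/-- `A` is a densely defined, selfadjoint, positive definite (in general unbounded) linear
operator in the Hilbert space `H`, with a compact inverse. -/
structure IsPosDefSelfAdjointCompactInverse (A : H →ₗ.[𝕜] H) : Prop where
  dense_domain : Dense (A.domain : Set H)
  selfAdjoint : A.adjoint = A
  pos : ∀ x : A.domain, x ≠ 0 → 0 < RCLike.re (inner 𝕜 (A x) (x : H))
  compact_inverse : ∃ K : H →L[𝕜] H, IsCompactOperator K ∧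
    (∀ y : H, ∃ h : K y ∈ A.domain, A ⟨K y, h⟩ = y) ∧ (∀ x : A.domain, K (A x) = x)

/-- The eigenspace `{x ∈ D(A) : A x = μ x}`; it is `{0}` if `μ` is not an eigenvalue. -/
def opEigenspace (A : H →ₗ.[𝕜] H) (μ : ℝ) : Submodule 𝕜 H where
  carrier := {x | ∃ h : x ∈ A.domain, A ⟨x, h⟩ = (μ : 𝕜) • x}
  zero_mem' := ⟨A.domain.zero_mem, by
    have h0 : (⟨0, A.domain.zero_mem⟩ : A.domain) = 0 := rfl
    rw [h0, LinearPMap.map_zero, smul_zero]⟩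
  add_mem' := by
    rintro x y ⟨hx, ex⟩ ⟨hy, ey⟩
    refine ⟨A.domain.add_mem hx hy, ?_⟩
    have h1 : (⟨x + y, A.domain.add_mem hx hy⟩ : A.domain) = ⟨x, hx⟩ + ⟨y, hy⟩ := rfl
    rw [h1, LinearPMap.map_add, ex, ey, smul_add]
  smul_mem' := by
    rintro k x ⟨hx, ex⟩
    refine ⟨A.domain.smul_mem k hx, ?_⟩
    have h1 : (⟨k • x, A.domain.smul_mem k hx⟩ : A.domain) = k • ⟨x, hx⟩ := rfl
    rw [h1, LinearPMap.map_smul, ex, smul_comm]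

/-- The operator function `φ(A)` for a selfadjoint `A` with compact inverse, through the spectral
decomposition: `φ(A) v = ∑_μ φ(μ) P_μ v`, where `μ` runs over the eigenvalues of `A` and `P_μ` is
the orthogonal projection onto the eigenspace of `μ` (the terms of other `μ` vanish; the
eigenspaces of a selfadjoint operator are closed, so that taking the closure changes nothing). -/
def opFun (A : H →ₗ.[𝕜] H) (φ : ℝ → ℝ) (v : H) : H :=
  ∑' μ : ℝ, (φ μ : 𝕜) • (opEigenspace A μ).topologicalClosure.starProjection v

/-- `(I + τ A)⁻¹ v`, through the inverse of the map `D(A) → H, w ↦ w + τ A w`. -/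
def resolventStep (A : H →ₗ.[𝕜] H) (τ : ℝ) (v : H) : H :=
  (Function.invFun (fun w : A.domain => (w : H) + (τ : 𝕜) • A w) v : A.domain)

/-- The coarse propagator (backward Euler) `𝒢(t, τ, v, f) = (I + τ A)⁻¹ (v + τ f(t))`. -/
def coarseProp (A : H →ₗ.[𝕜] H) (f : ℝ → H) (τ t : ℝ) (v : H) : H :=
  resolventStep A τ (v + (τ : 𝕜) • f t)

/-- The fine propagator `ℱ(t, τ, v, f) = r(-τ A) v + τ ∑ᵢ pᵢ(-τ A) f(t + cᵢ τ)` of the single step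
method given by the Butcher tableau `B`. -/
def fineProp {m : ℕ} (B : ButcherTableau m) (A : H →ₗ.[𝕜] H) (f : ℝ → H) (τ t : ℝ) (v : H) : H :=
  opFun A (fun μ => B.stab (-(τ * μ))) v +
    (τ : 𝕜) • ∑ i, opFun A (fun μ => B.src i (-(τ * μ))) (f (t + B.c i * τ))

/-- `j` successive fine steps of size `τ` from the value `v` at time `t`. -/
def fineSteps {m : ℕ} (B : ButcherTableau m) (A : H →ₗ.[𝕜] H) (f : ℝ → H) (τ t : ℝ) (v : H) :
    ℕ → H
  | 0 => v
  | j + 1 => fineProp B A f τ (t + j * τ) (fineSteps B A f τ t v j)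

/-- The solution `uⁿ` of the single step scheme with step size `τ` and `u⁰ = u0`. -/
def timeStepping {m : ℕ} (B : ButcherTableau m) (A : H →ₗ.[𝕜] H) (f : ℝ → H) (u0 : H) (τ : ℝ) :
    ℕ → H :=
  fineSteps B A f τ 0 u0

/-- The initial guess `U₀ⁿ` of the parareal iteration, by coarse steps of size `τ`. -/
def pararealInit (A : H →ₗ.[𝕜] H) (f : ℝ → H) (u0 : H) (τ : ℝ) : ℕ → H
  | 0 => u0
  | n + 1 => coarseProp A f τ (n * τ) (pararealInit A f u0 τ n)

/-- One sweep of the parareal iteration, from `(Vⁿ)ₙ = (U_kⁿ)ₙ` to `(U_{k+1}ⁿ)ₙ`, with coarse step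
size `J τ` and fine step size `τ`. -/
def pararealSweep {m : ℕ} (B : ButcherTableau m) (A : H →ₗ.[𝕜] H) (f : ℝ → H) (u0 : H) (τ : ℝ)
    (J : ℕ) (V : ℕ → H) : ℕ → H
  | 0 => u0
  | n + 1 =>
      coarseProp A f (J * τ) (n * (J * τ)) (pararealSweep B A f u0 τ J V n)
        + fineSteps B A f τ (n * (J * τ)) (V n) J
        - coarseProp A f (J * τ) (n * (J * τ)) (V n)

/-- The parareal iterates `U_kⁿ`, with fine step size `τ` and coarse step size `J τ`. -/
def parareal {m : ℕ} (B : ButcherTableau m) (A : H →ₗ.[𝕜] H) (f : ℝ → H) (u0 : H) (τ : ℝ)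
    (J : ℕ) : ℕ → ℕ → H
  | 0 => pararealInit A f u0 (J * τ)
  | k + 1 => pararealSweep B A f u0 τ J (parareal B A f u0 τ J k)

end Operator

end

/-! Everything is diagonal in the spectral decomposition of `A`. In the mode `μ`, put `g = (1 + J τ
μ)⁻¹` and `q = r(-τ μ) ^ J`. The sources cancel from the parareal error, which obeys `e_{k+1}^{n+1}
= g e_{k+1}^n + (q - g) e_k^n` with `e_k^0 = 0`. If `|q - g| ≤ 0.31 (1 - g)`
(`abs_stab_pow_sub_le`), induction on `n` gives `sup_n |e_{k+1}^n| ≤ 0.31 sup_n |e_k^n|`, uniformly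
in `μ`.

For the scalar inequality, `exp (-s) ≤ r(-s) ≤ (1 + s)⁻¹` and Bernoulli's inequality give `exp (-x)
≤ q ≤ g` with `x = J s`. What remains, free of `J`, is `1 - 0.31 x ≤ (1 + x) exp (-x)`, obtained
from a Padé bound for `exp`.

The initial error in each mode is bounded by a combination of component norms of `u0` and values of
`f`. These form a vector of `ℓ²`, so Minkowski and Parseval turn the modewise bounds into the bound
in `H` (`norm_parareal_sub_le`). -/

noncomputable section

/-! ### Rational functions of the Lobatto IIIC method. -/

/-- The transposed linear system `pᵀ (I + s a) = bᵀ` determines the functions `pᵢ(-s)`. -/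
theorem ButcherTableau.src_neg_eq_of_vecMul {m : ℕ} (B : ButcherTableau m) (s : ℝ) (w : Fin m → ℝ)
    (hdet : (1 + s • B.a).det ≠ 0) (hw : Matrix.vecMul w (1 + s • B.a) = B.b) :
    (fun i => B.src i (-s)) = w := by
  have e : (1 - (-s) • B.a) = 1 + s • B.a := by simp
  funext i
  rw [ButcherTableau.src, e, ← hw, Matrix.vecMul_vecMul, Matrix.mul_nonsing_inv _ hdet.isUnit,
    Matrix.vecMul_one]

theorem ButcherTableau.stab_eq_sum_src {m : ℕ} (B : ButcherTableau m) (z : ℝ) :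
    B.stab z = 1 + z * ∑ i, B.src i z := by
  rw [ButcherTableau.stab, Matrix.dotProduct_mulVec]
  simp [dotProduct, ButcherTableau.src]

/-- The common denominator, normalised as `360 det (I + s a)`. -/
def lobattoDenom (s : ℝ) : ℝ := s ^ 4 + 12 * s ^ 3 + 72 * s ^ 2 + 240 * s + 360

def lobattoNum (s : ℝ) : ℝ := 12 * s ^ 2 - 120 * s + 360

theorem lobattoDenom_pos {s : ℝ} (hs : 0 ≤ s) : 0 < lobattoDenom s := by
  unfold lobattoDenom; positivity

theorem lobattoNum_pos (s : ℝ) : 0 < lobattoNum s := by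
  unfold lobattoNum; nlinarith [sq_nonneg (s - 5)]

def lobattoSrcNum (s : ℝ) : Fin 4 → ℝ :=
  ![30 - 10 * s + s ^ 2,
    150 + (25 - 15 * √5) * s + (5 / 2 - 5 / 2 * √5) * s ^ 2,
    150 + (25 + 15 * √5) * s + (5 / 2 + 5 / 2 * √5) * s ^ 2,
    30 + 20 * s + 6 * s ^ 2 + s ^ 3]

theorem one_add_smul_lobattoIIIC4 (s : ℝ) :
    1 + s • lobattoIIIC4.a =
      !![1 + s * (1 / 12), s * (-√5 / 12), s * (√5 / 12), s * (-1 / 12);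
         s * (1 / 12), 1 + s * (1 / 4), s * ((10 - 7 * √5) / 60), s * (√5 / 60);
         s * (1 / 12), s * ((10 + 7 * √5) / 60), 1 + s * (1 / 4), s * (-√5 / 60);
         s * (1 / 12), s * (5 / 12), s * (5 / 12), 1 + s * (1 / 12)] := by
  ext i j
  rw [Matrix.add_apply, Matrix.smul_apply, smul_eq_mul, Matrix.one_apply]
  fin_cases i <;> fin_cases j <;> simp [lobattoIIIC4]

theorem det_one_add_smul_lobattoIIIC4 (s : ℝ) :
    (1 + s • lobattoIIIC4.a).det = lobattoDenom s / 360 := by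
  have h5 : √5 ^ 2 = 5 := Real.sq_sqrt (by norm_num)
  rw [one_add_smul_lobattoIIIC4]
  generalize √5 = r at h5 ⊢
  simp [Matrix.det_succ_row_zero, lobattoDenom, Fin.sum_univ_succ, Fin.succAbove]
  ring_nf
  simp only [h5]
  ring

theorem vecMul_lobattoSrcNum (s : ℝ) :
    Matrix.vecMul (lobattoSrcNum s) (1 + s • lobattoIIIC4.a) =
      lobattoDenom s • lobattoIIIC4.b := by
  have h5 : √5 ^ 2 = 5 := Real.sq_sqrt (by norm_num)
  rw [one_add_smul_lobattoIIIC4]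
  unfold lobattoSrcNum
  generalize √5 = r at h5 ⊢
  funext i
  fin_cases i <;>
  · simp [Matrix.vecMul, dotProduct, Fin.sum_univ_four, lobattoIIIC4, lobattoDenom]
    ring_nf
    try simp only [h5]
    try ring

theorem lobattoIIIC4_src_neg {s : ℝ} (hs : 0 ≤ s) (i : Fin 4) :
    lobattoIIIC4.src i (-s) = lobattoSrcNum s i / lobattoDenom s := by
  have hQ := lobattoDenom_pos hs
  have := lobattoIIIC4.src_neg_eq_of_vecMul s ((lobattoDenom s)⁻¹ • lobattoSrcNum s)
    (by rw [det_one_add_smul_lobattoIIIC4]; positivity)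
    (by rw [Matrix.smul_vecMul, vecMul_lobattoSrcNum, smul_smul, inv_mul_cancel₀ hQ.ne', one_smul])
  rw [congrFun this i, Pi.smul_apply, smul_eq_mul, inv_mul_eq_div]

theorem lobattoIIIC4_stab_neg {s : ℝ} (hs : 0 ≤ s) :
    lobattoIIIC4.stab (-s) = lobattoNum s / lobattoDenom s := by
  have hQ := lobattoDenom_pos hs
  simp only [lobattoIIIC4.stab_eq_sum_src, lobattoIIIC4_src_neg hs, ← Finset.sum_div]
  rw [eq_div_iff hQ.ne', add_mul, mul_assoc, div_mul_cancel₀ _ hQ.ne']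
  simp [Fin.sum_univ_succ, lobattoSrcNum, lobattoNum, lobattoDenom]
  ring

theorem abs_lobattoIIIC4_src_neg_le {s : ℝ} (hs : 0 ≤ s) (i : Fin 4) :
    |lobattoIIIC4.src i (-s)| ≤ 1 := by
  have hQ := lobattoDenom_pos hs
  have h5 : √5 ≤ 3 := Real.sqrt_le_iff.2 (by norm_num)
  have h5' : 0 ≤ √5 := Real.sqrt_nonneg 5
  have h1 : √5 * s ≤ 3 * s := by gcongr
  have h2 : √5 * s ^ 2 ≤ 3 * s ^ 2 := by gcongr
  have h1' : 0 ≤ √5 * s := by positivity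
  have h2' : 0 ≤ √5 * s ^ 2 := by positivity
  have h3 : 0 ≤ s ^ 2 := by positivity
  have h4 : 0 ≤ s ^ 3 := by positivity
  have h6 : 0 ≤ s ^ 4 := by positivity
  rw [lobattoIIIC4_src_neg hs, abs_div, abs_of_pos hQ, div_le_one hQ, abs_le]
  unfold lobattoDenom
  fin_cases i <;> simp [lobattoSrcNum] <;> constructor <;> linarith

theorem lobattoIIIC4_stab_neg_nonneg {s : ℝ} (hs : 0 ≤ s) : 0 ≤ lobattoIIIC4.stab (-s) := by
  rw [lobattoIIIC4_stab_neg hs]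
  exact (div_pos (lobattoNum_pos s) (lobattoDenom_pos hs)).le

theorem lobattoIIIC4_stab_neg_le {s : ℝ} (hs : 0 ≤ s) :
    lobattoIIIC4.stab (-s) ≤ (1 + s)⁻¹ := by
  rw [lobattoIIIC4_stab_neg hs, ← one_div, div_le_div_iff₀ (lobattoDenom_pos hs) (by linarith)]
  unfold lobattoNum lobattoDenom
  -- After cross-multiplication the difference of the two sides is `s ^ 4 + 180 s ^ 2`.
  nlinarith [sq_nonneg s, sq_nonneg (s ^ 2)]

/-! ### Exponential bounds and the scalar contraction estimate. -/

theorem monotoneOn_Ici_of_hasDerivAt {g g' : ℝ → ℝ}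
    (hg : ∀ x, 0 ≤ x → HasDerivAt g (g' x) x) (hg' : ∀ x, 0 ≤ x → 0 ≤ g' x) :
    MonotoneOn g (Set.Ici 0) := by
  refine monotoneOn_of_deriv_nonneg (convex_Ici 0)
    (fun x hx => (hg x hx).continuousAt.continuousWithinAt) ?_ ?_
  · intro x hx
    rw [interior_Ici] at hx
    exact (hg x (le_of_lt hx)).differentiableAt.differentiableWithinAt
  · intro x hx
    rw [interior_Ici] at hx
    rw [(hg x (le_of_lt hx)).deriv]
    exact hg' x (le_of_lt hx)

theorem hasDerivAt_lobattoNum (s : ℝ) : HasDerivAt lobattoNum (24 * s - 120) s := by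
  have := (((hasDerivAt_id s).pow 2).const_mul 12).sub ((hasDerivAt_id s).const_mul 120)
    |>.add_const 360
  refine (this.congr_deriv ?_).congr_of_eventuallyEq ?_
  · simp; ring
  · exact Filter.Eventually.of_forall fun x => by simp [lobattoNum]

theorem hasDerivAt_lobattoDenom (s : ℝ) :
    HasDerivAt lobattoDenom (4 * s ^ 3 + 36 * s ^ 2 + 144 * s + 240) s := by
  have := ((((hasDerivAt_id s).pow 4).add (((hasDerivAt_id s).pow 3).const_mul 12)).add
    (((hasDerivAt_id s).pow 2).const_mul 72)).add ((hasDerivAt_id s).const_mul 240)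
    |>.add_const 360
  refine (this.congr_deriv ?_).congr_of_eventuallyEq ?_
  · simp; ring
  · exact Filter.Eventually.of_forall fun x => by simp [lobattoDenom]

/-- The stability function is a Padé approximant of `exp`, so nearly everything cancels in the
derivative of `exp x * r(-x)`: only a nonnegative multiple of `x ^ 6` survives. The product
therefore increases from its value `1` at `0`. -/
theorem exp_neg_le_lobattoIIIC4_stab_neg {s : ℝ} (hs : 0 ≤ s) :
    Real.exp (-s) ≤ lobattoIIIC4.stab (-s) := by
  have hmono : MonotoneOn (fun x => Real.exp x * lobattoNum x / lobattoDenom x) (Set.Ici 0) := by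
    refine monotoneOn_Ici_of_hasDerivAt
      (g' := fun x => 12 * x ^ 6 * Real.exp x / lobattoDenom x ^ 2) ?_ ?_
    · intro x hx
      refine (((Real.hasDerivAt_exp x).mul (hasDerivAt_lobattoNum x)).div
        (hasDerivAt_lobattoDenom x) (lobattoDenom_pos hx).ne').congr_deriv ?_
      congr 1
      simp only [lobattoNum, lobattoDenom, Pi.mul_apply]
      ring
    · intro x hx
      have := lobattoDenom_pos hx
      positivity
  have h := hmono (Set.mem_Ici.2 le_rfl) (Set.mem_Ici.2 hs) hs
  simp only [Real.exp_zero] at h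
  rw [show (1 : ℝ) * lobattoNum 0 / lobattoDenom 0 = 1 by norm_num [lobattoNum, lobattoDenom],
    mul_div_assoc] at h
  rw [lobattoIIIC4_stab_neg hs, Real.exp_neg, inv_le_iff_one_le_mul₀' (Real.exp_pos s)]
  exact h

/-- The `(3,3)` Padé approximation bounds the exponential function from above. -/
theorem pade_mul_exp_le {x : ℝ} (hx : 0 ≤ x) :
    (120 - 60 * x + 12 * x ^ 2 - x ^ 3) * Real.exp x ≤ 120 + 60 * x + 12 * x ^ 2 + x ^ 3 := by
  have hD : ∀ y : ℝ, 0 ≤ y → 0 < 120 + 60 * y + 12 * y ^ 2 + y ^ 3 := fun y hy => by positivity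
  -- The quotient of the two sides equals `1` at `0` and decreases; the sign is flipped to reuse the
  -- monotonicity criterion.
  have hmono : MonotoneOn (fun y => -((120 - 60 * y + 12 * y ^ 2 - y ^ 3) * Real.exp y /
      (120 + 60 * y + 12 * y ^ 2 + y ^ 3))) (Set.Ici 0) := by
    refine monotoneOn_Ici_of_hasDerivAt
      (g' := fun y => y ^ 6 * Real.exp y / (120 + 60 * y + 12 * y ^ 2 + y ^ 3) ^ 2) ?_ ?_
    · intro y hy
      have h1 : HasDerivAt (fun y : ℝ => 120 - 60 * y + 12 * y ^ 2 - y ^ 3)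
          (-60 + 24 * y - 3 * y ^ 2) y := by
        have := ((((hasDerivAt_id y).const_mul 60).const_sub 120).add
          (((hasDerivAt_id y).pow 2).const_mul 12)).sub ((hasDerivAt_id y).pow 3)
        refine (this.congr_deriv ?_).congr_of_eventuallyEq ?_
        · simp; ring
        · exact Filter.Eventually.of_forall fun x => by simp
      have h2 : HasDerivAt (fun y : ℝ => 120 + 60 * y + 12 * y ^ 2 + y ^ 3)
          (60 + 24 * y + 3 * y ^ 2) y := by
        have := ((((hasDerivAt_id y).const_mul 60).const_add 120).add
          (((hasDerivAt_id y).pow 2).const_mul 12)).add ((hasDerivAt_id y).pow 3)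
        refine (this.congr_deriv ?_).congr_of_eventuallyEq ?_
        · simp; ring
        · exact Filter.Eventually.of_forall fun x => by simp
      refine ((h1.mul (Real.hasDerivAt_exp y)).div h2 (hD y hy).ne').neg.congr_deriv ?_
      rw [← neg_div]
      congr 1
      simp only [Pi.mul_apply]
      ring
    · intro y hy
      positivity
  have h := hmono (Set.mem_Ici.2 le_rfl) (Set.mem_Ici.2 hx) hx
  simp only [Real.exp_zero] at h
  norm_num at h
  exact (div_le_one (hD x hx)).1 h

theorem one_sub_mul_le_one_add_mul_exp_neg {x : ℝ} (hx : 0 ≤ x) :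
    1 - 0.31 * x ≤ (1 + x) * Real.exp (-x) := by
  rcases le_total 1 (0.31 * x) with h | h
  · exact (sub_nonpos.2 h).trans (by positivity)
  · have hx4 : x ≤ 4 := by linarith
    have hD : 0 < 120 - 60 * x + 12 * x ^ 2 - x ^ 3 := by
      nlinarith [sq_nonneg (x - 4), mul_nonneg (sq_nonneg x) (sub_nonneg.2 hx4)]
    have hp := pade_mul_exp_le hx
    have hpoly : (1 - 0.31 * x) * (120 + 60 * x + 12 * x ^ 2 + x ^ 3) ≤
        (1 + x) * (120 - 60 * x + 12 * x ^ 2 - x ^ 3) := by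
      -- The difference of the two sides of `hpoly` is `x` times this cubic. The value `1.8` is
      -- close to its local minimum, and `3.226` slightly exceeds `1 / 0.31`.
      have : 0 ≤ 37.2 - 41.4 * x + 13.72 * x ^ 2 - 0.69 * x ^ 3 := by
        have h326 : x ≤ 3.226 := by linarith
        nlinarith [sq_nonneg (x - 1.8), mul_nonneg (sq_nonneg (x - 1.8)) (sub_nonneg.2 h326),
          mul_nonneg (sq_nonneg x) (sub_nonneg.2 h326)]
      nlinarith [mul_nonneg hx this]
    have key : (1 - 0.31 * x) * Real.exp x ≤ 1 + x := by
      have := mul_le_mul_of_nonneg_left hp (sub_nonneg.2 h)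
      refine le_of_mul_le_mul_right ?_ hD
      linarith
    rw [Real.exp_neg, ← div_eq_mul_inv, le_div_iff₀ (Real.exp_pos x)]
    exact key

/-- The scalar contraction estimate behind the linear convergence of the parareal iteration. -/
theorem abs_stab_pow_sub_le {s : ℝ} (hs : 0 ≤ s) (J : ℕ) :
    |lobattoIIIC4.stab (-s) ^ J - (1 + J * s)⁻¹| ≤ 0.31 * (1 - (1 + J * s)⁻¹) := by
  have hx : 0 ≤ J * s := by positivity
  have h1x : 0 < 1 + J * s := by positivity
  have hup : lobattoIIIC4.stab (-s) ^ J ≤ (1 + J * s)⁻¹ :=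
    calc lobattoIIIC4.stab (-s) ^ J ≤ ((1 + s)⁻¹) ^ J :=
          pow_le_pow_left₀ (lobattoIIIC4_stab_neg_nonneg hs) (lobattoIIIC4_stab_neg_le hs) J
      _ ≤ (1 + J * s)⁻¹ := by
          rw [inv_pow]
          exact inv_anti₀ h1x (one_add_mul_le_pow (by linarith) J)
  have hlow : Real.exp (-(J * s)) ≤ lobattoIIIC4.stab (-s) ^ J := by
    have := pow_le_pow_left₀ (Real.exp_pos _).le (exp_neg_le_lobattoIIIC4_stab_neg hs) J
    rwa [← Real.exp_nat_mul, mul_neg] at this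
  have h := one_sub_mul_le_one_add_mul_exp_neg hx
  rw [abs_of_nonpos (sub_nonpos.2 hup)]
  -- With `x = J s` and `g = (1 + x)⁻¹` one has `1 - g = x g`, so the goal reduces to `(1 - 0.31 x)
  -- g ≤ exp (-x)`.
  have h2 : (1 - 0.31 * (J * s)) * (1 + J * s)⁻¹ ≤ Real.exp (-(J * s)) := by
    rw [← div_eq_mul_inv, div_le_iff₀ h1x]; linarith
  have h3 : (J * s) * (1 + J * s)⁻¹ = 1 - (1 + J * s)⁻¹ := by field_simp; ring
  linarith

/-! ### Spectral decomposition of `A` and its functional calculus. -/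

section Spectral

variable {𝕜 H : Type*} [RCLike 𝕜] [NormedAddCommGroup H] [InnerProductSpace 𝕜 H] [CompleteSpace H]

/-- The orthogonal projection onto the (closure of the) eigenspace of `μ`. -/
def eigenProj (A : H →ₗ.[𝕜] H) (μ : ℝ) : H →L[𝕜] H :=
  (opEigenspace A μ).topologicalClosure.starProjection

namespace IsPosDefSelfAdjointCompactInverse

variable {A : H →ₗ.[𝕜] H}

theorem inner_apply_left (hA : IsPosDefSelfAdjointCompactInverse A) (x y : A.domain) :
    inner 𝕜 (A x) (y : H) = inner 𝕜 (x : H) (A y) := by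
  have h := LinearPMap.adjoint_isFormalAdjoint (T := A) hA.dense_domain
  rw [hA.selfAdjoint] at h
  exact h x y

theorem pos_of_mem_opEigenspace (hA : IsPosDefSelfAdjointCompactInverse A)
    {μ : ℝ} {x : H} (hx : x ∈ opEigenspace A μ) (h0 : x ≠ 0) :
    0 < μ := by
  obtain ⟨h, e⟩ := hx
  have hp := hA.pos ⟨x, h⟩ (fun h' => h0 (congrArg Subtype.val h'))
  rw [e, inner_smul_left, inner_self_eq_norm_sq_to_K, RCLike.conj_ofReal] at hp
  norm_cast at hp
  exact (pos_iff_pos_of_mul_pos hp).2 (by positivity)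

theorem isOrtho_opEigenspace (hA : IsPosDefSelfAdjointCompactInverse A) {μ ν : ℝ} (h : μ ≠ ν) :
    opEigenspace A μ ⟂ opEigenspace A ν := by
  rw [Submodule.isOrtho_iff_inner_eq]
  rintro x ⟨hx, ex⟩ y ⟨hy, ey⟩
  have := hA.inner_apply_left ⟨x, hx⟩ ⟨y, hy⟩
  rw [ex, ey, inner_smul_left, inner_smul_right, RCLike.conj_ofReal] at this
  have h2 : ((μ : 𝕜) - ν) * inner 𝕜 x y = 0 := by rw [sub_mul, sub_eq_zero]; exact this
  refine (mul_eq_zero.1 h2).resolve_left (sub_ne_zero.2 ?_)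
  exact_mod_cast h

theorem orthogonalFamily_opEigenspace (hA : IsPosDefSelfAdjointCompactInverse A) :
    OrthogonalFamily 𝕜 (fun μ : ℝ => (opEigenspace A μ).topologicalClosure)
      fun μ => (opEigenspace A μ).topologicalClosure.subtypeₗᵢ := by
  refine OrthogonalFamily.of_pairwise fun μ ν h => ?_
  change _ ≤ _
  rw [Submodule.orthogonal_closure]
  refine Submodule.topologicalClosure_minimal _ (hA.isOrtho_opEigenspace h)
    (Submodule.isClosed_orthogonal _)

/-- The spectral theorem for the compact symmetric inverse `K` supplies a total family of
eigenvectors. Their eigenvalues are real by symmetry and nonzero because `K` is injective, so an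
eigenvector of `K` for `ν` is one of `A` for `ν⁻¹`. -/
theorem orthogonal_iSup_opEigenspace (hA : IsPosDefSelfAdjointCompactInverse A)
    : (⨆ μ : ℝ, opEigenspace A μ)ᗮ = ⊥ := by
  obtain ⟨K, hK, hAK, hKA⟩ := hA.compact_inverse
  have hsymm : (K : H →ₗ[𝕜] H).IsSymmetric := by
    intro x y
    obtain ⟨hx, ex⟩ := hAK x
    obtain ⟨hy, ey⟩ := hAK y
    have := hA.inner_apply_left ⟨K x, hx⟩ ⟨K y, hy⟩
    rw [ex, ey] at this
    exact this.symm
  have htot := ContinuousLinearMap.orthogonalComplement_iSup_eigenspaces_eq_bot hK hsymm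
  rw [eq_bot_iff, ← htot]
  refine Submodule.orthogonal_le (iSup_le fun ν => ?_)
  intro x hx
  by_cases h0 : x = 0
  · rw [h0]; exact Submodule.zero_mem _
  have hν : (starRingEnd 𝕜) ν = ν := hsymm.conj_eigenvalue_eq_self
    (Module.End.hasEigenvalue_of_hasEigenvector ⟨hx, h0⟩)
  rw [Module.End.mem_eigenspace_iff] at hx
  have hx' : K x = ν • x := hx
  obtain ⟨h, e⟩ := hAK x
  have hν0 : ν ≠ 0 := by
    rintro rfl
    apply h0
    rw [← e]
    have : (⟨K x, h⟩ : A.domain) = 0 := Subtype.ext (by simpa using hx')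
    rw [this, LinearPMap.map_zero]
  obtain ⟨r, hr⟩ := RCLike.conj_eq_iff_real.1 hν
  have hxd : x ∈ A.domain := by
    have := A.domain.smul_mem ν⁻¹ h
    rwa [hx', smul_smul, inv_mul_cancel₀ hν0, one_smul] at this
  refine Submodule.mem_iSup_of_mem r⁻¹ ⟨hxd, ?_⟩
  have h3 : (⟨K x, h⟩ : A.domain) = ν • ⟨x, hxd⟩ := Subtype.ext hx'
  rw [h3, LinearPMap.map_smul] at e
  rw [RCLike.ofReal_inv, ← hr, eq_inv_smul_iff₀ hν0, e]

theorem isHilbertSum_opEigenspace (hA : IsPosDefSelfAdjointCompactInverse A) :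
    IsHilbertSum 𝕜 (fun μ : ℝ => (opEigenspace A μ).topologicalClosure)
      fun μ => (opEigenspace A μ).topologicalClosure.subtypeₗᵢ := by
  refine IsHilbertSum.mkInternal _ hA.orthogonalFamily_opEigenspace ?_
  rw [top_le_iff, Submodule.topologicalClosure_eq_top_iff, eq_bot_iff,
    ← hA.orthogonal_iSup_opEigenspace]
  exact Submodule.orthogonal_le (iSup_mono fun μ => Submodule.le_topologicalClosure _)

theorem eigenProj_apply_of_mem (hA : IsPosDefSelfAdjointCompactInverse A) {μ ν : ℝ} {x : H}
    (hx : x ∈ (opEigenspace A ν).topologicalClosure) :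
    eigenProj A μ x = if ν = μ then x else 0 := by
  split_ifs with h
  · subst h
    exact Submodule.starProjection_eq_self_iff.2 hx
  · refine (Submodule.starProjection_apply_eq_zero_iff _).2 ?_
    exact (hA.orthogonalFamily_opEigenspace.isOrtho h) hx

theorem eigenProj_hasSum (hA : IsPosDefSelfAdjointCompactInverse A) {x : H} {w : ℝ → H}
    (hw : ∀ μ, w μ ∈ (opEigenspace A μ).topologicalClosure) (hx : HasSum w x) (μ : ℝ) :
    eigenProj A μ x = w μ := by
  have h := (eigenProj A μ).hasSum hx
  have h2 : HasSum (fun ν => eigenProj A μ (w ν)) (eigenProj A μ (w μ)) :=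
    hasSum_single μ fun ν hν => by rw [hA.eigenProj_apply_of_mem (hw ν), if_neg hν]
  rw [h.unique h2, hA.eigenProj_apply_of_mem (hw μ), if_pos rfl]

/-- Parseval's identity: the norms of the spectral components of `v` form a square summable
family, whose norm is that of `v`. -/
theorem exists_lp_norm_eigenProj (hA : IsPosDefSelfAdjointCompactInverse A) (v : H) :
    ∃ N : lp (fun _ : ℝ => ℝ) 2, ‖N‖ = ‖v‖ ∧ ∀ μ, N μ = ‖eigenProj A μ v‖ := by
  obtain ⟨w, hw⟩ := hA.isHilbertSum_opEigenspace.surjective_isometry v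
  have hs := hA.isHilbertSum_opEigenspace.OrthogonalFamily.hasSum_linearIsometry w
  rw [hw] at hs
  have hproj : ∀ μ, eigenProj A μ v = w μ := hA.eigenProj_hasSum (fun μ => (w μ).2) hs
  have hmem : Memℓp (fun μ => ‖eigenProj A μ v‖) 2 := by
    refine memℓp_gen ?_
    have := (lp.memℓp w).summable (by norm_num)
    simpa [hproj] using this
  refine ⟨⟨_, hmem⟩, ?_, fun μ => rfl⟩
  have hn : ‖v‖ = ‖w‖ := by rw [← hw, LinearIsometry.norm_map]
  rw [hn, lp.norm_eq_tsum_rpow (by norm_num),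
    lp.norm_eq_tsum_rpow (by norm_num)]
  simp [hproj]

theorem eigenProj_of_nonpos (hA : IsPosDefSelfAdjointCompactInverse A)
    {μ : ℝ} (hμ : μ ≤ 0) (v : H) : eigenProj A μ v = 0 := by
  have : opEigenspace A μ = ⊥ := by
    rw [eq_bot_iff]
    intro x hx
    by_contra h0
    exact absurd (hA.pos_of_mem_opEigenspace hx h0) (not_lt.2 hμ)
  refine (Submodule.starProjection_apply_eq_zero_iff _).2 ?_
  rw [Submodule.orthogonal_closure, this, Submodule.bot_orthogonal_eq_top]
  trivial

theorem eq_of_eigenProj_eq (hA : IsPosDefSelfAdjointCompactInverse A)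
    {v w : H} (h : ∀ μ, eigenProj A μ v = eigenProj A μ w) : v = w := by
  obtain ⟨N, hN, hNμ⟩ := hA.exists_lp_norm_eigenProj (v - w)
  have : N = 0 := by
    ext μ
    rw [hNμ, map_sub, h, sub_self, norm_zero]
    rfl
  rw [this, norm_zero] at hN
  exact sub_eq_zero.1 (norm_eq_zero.1 hN.symm)

theorem norm_le_of_norm_eigenProj_le (hA : IsPosDefSelfAdjointCompactInverse A)
    {v : H} (N : lp (fun _ : ℝ => ℝ) 2)
    (h : ∀ μ, ‖eigenProj A μ v‖ ≤ N μ) : ‖v‖ ≤ ‖N‖ := by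
  obtain ⟨N', hN', hNμ⟩ := hA.exists_lp_norm_eigenProj v
  rw [← hN']
  refine lp.norm_mono (by norm_num) fun μ => ?_
  rw [hNμ, norm_norm]
  exact (h μ).trans (le_abs_self _)

/-- Bounded functions of `A` act diagonally on the spectral components. -/
theorem eigenProj_opFun (hA : IsPosDefSelfAdjointCompactInverse A)
    {φ : ℝ → ℝ} {C : ℝ} (hφ : ∀ μ, 0 < μ → |φ μ| ≤ C) (v : H) (μ : ℝ) :
    eigenProj A μ (opFun A φ v) = (φ μ : 𝕜) • eigenProj A μ v := by
  have hmem : ∀ ν, (φ ν : 𝕜) • eigenProj A ν v ∈ (opEigenspace A ν).topologicalClosure :=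
    fun ν => Submodule.smul_mem _ _ (Submodule.starProjection_apply_mem _ _)
  obtain ⟨N, -, hNμ⟩ := hA.exists_lp_norm_eigenProj v
  have hN2 : Summable fun ν => C ^ 2 * ‖eigenProj A ν v‖ ^ 2 := by
    have := (lp.memℓp N).summable (by norm_num)
    simp only [hNμ, norm_norm] at this
    exact Summable.mul_left _ (by simpa using this)
  have hsum : Summable fun ν => (φ ν : 𝕜) • eigenProj A ν v := by
    refine (hA.orthogonalFamily_opEigenspace.summable_iff_norm_sq_summable
      (fun ν => ⟨_, hmem ν⟩)).2 (Summable.of_nonneg_of_le (fun ν => by positivity) ?_ hN2)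
    intro ν
    rw [Submodule.coe_norm, norm_smul, mul_pow, RCLike.norm_ofReal]
    rcases le_or_gt ν 0 with hν | hν
    · simp [hA.eigenProj_of_nonpos hν]
    · have := hφ ν hν
      gcongr
  exact hA.eigenProj_hasSum hmem hsum.hasSum μ

/-- By symmetry of `A`, the vector `A x - μ x` is orthogonal to the eigenspace of `μ`. -/
theorem eigenProj_apply (hA : IsPosDefSelfAdjointCompactInverse A) (x : A.domain) (μ : ℝ) :
    eigenProj A μ (A x) = (μ : 𝕜) • eigenProj A μ x := by
  rw [← sub_eq_zero, ← map_smul, ← map_sub]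
  refine (Submodule.starProjection_apply_eq_zero_iff _).2 ?_
  rw [Submodule.orthogonal_closure]
  rintro y ⟨hy, ey⟩
  have := hA.inner_apply_left ⟨y, hy⟩ x
  rw [ey, inner_smul_left, RCLike.conj_ofReal] at this
  rw [inner_sub_right, inner_smul_right, this, sub_self]

theorem exists_add_smul_eq (hA : IsPosDefSelfAdjointCompactInverse A) {τ : ℝ} (hτ : 0 < τ) (v : H) :
    ∃ w : A.domain, (w : H) + (τ : 𝕜) • A w = v := by
  obtain ⟨K, -, hAK, -⟩ := hA.compact_inverse
  -- Here `y` plays the role of `A (I + τ A)⁻¹ v`, a bounded function of `A`. Taking `K y` as the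
  -- solution makes membership in the domain automatic.
  set y := opFun A (fun μ => μ / (1 + τ * μ)) v
  obtain ⟨h, e⟩ := hAK y
  refine ⟨⟨K y, h⟩, hA.eq_of_eigenProj_eq fun μ => ?_⟩
  rcases le_or_gt μ 0 with hμ | hμ
  · simp only [hA.eigenProj_of_nonpos hμ]
  have hy : eigenProj A μ y = ((μ / (1 + τ * μ) : ℝ) : 𝕜) • eigenProj A μ v := by
    refine hA.eigenProj_opFun (C := 1 / τ) (fun ν hν => ?_) v μ
    rw [abs_of_nonneg (by positivity), div_le_div_iff₀ (by positivity) hτ]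
    linarith
  have hKy := hA.eigenProj_apply ⟨K y, h⟩ μ
  rw [e, hy] at hKy
  have hKy' : eigenProj A μ (K y) = (((1 + τ * μ)⁻¹ : ℝ) : 𝕜) • eigenProj A μ v := by
    have hμ' : (μ : 𝕜) ≠ 0 := by exact_mod_cast hμ.ne'
    rw [← inv_smul_smul₀ hμ' (eigenProj A μ (K y)), ← hKy, smul_smul]
    congr 1
    rw [← RCLike.ofReal_inv, ← RCLike.ofReal_mul]
    congr 1
    field_simp
  rw [e, map_add, map_smul, hKy', hy, smul_smul, ← add_smul, ← RCLike.ofReal_mul,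
    ← RCLike.ofReal_add]
  rw [show (1 + τ * μ)⁻¹ + τ * (μ / (1 + τ * μ)) = 1 by field_simp, RCLike.ofReal_one, one_smul]

/-- Any solution of `w + τ A w = v` has these components, so existence of a preimage is enough to
evaluate `invFun`. -/
theorem eigenProj_resolventStep (hA : IsPosDefSelfAdjointCompactInverse A)
    {τ : ℝ} (hτ : 0 < τ) (v : H) {μ : ℝ} (hμ : 0 ≤ μ) :
    eigenProj A μ (resolventStep A τ v) = (((1 + τ * μ)⁻¹ : ℝ) : 𝕜) • eigenProj A μ v := by
  have h := Function.invFun_eq (f := fun w : A.domain => (w : H) + (τ : 𝕜) • A w)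
    (hA.exists_add_smul_eq hτ v)
  have h2 := congrArg (eigenProj A μ) h
  rw [map_add, map_smul, hA.eigenProj_apply, smul_smul] at h2
  have h1 : (1 + τ * μ) ≠ 0 := by positivity
  rw [← h2, resolventStep, smul_add, smul_smul, ← add_smul, ← RCLike.ofReal_mul,
    ← RCLike.ofReal_mul, ← RCLike.ofReal_add,
    show (1 + τ * μ)⁻¹ + (1 + τ * μ)⁻¹ * (τ * μ) = 1 by field_simp, RCLike.ofReal_one, one_smul]

end IsPosDefSelfAdjointCompactInverse

end Spectral

/-! ### Propagators and parareal error in a single spectral mode. -/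

theorem abs_lobattoIIIC4_stab_neg_le {s : ℝ} (hs : 0 ≤ s) : |lobattoIIIC4.stab (-s)| ≤ 1 := by
  rw [abs_of_nonneg (lobattoIIIC4_stab_neg_nonneg hs)]
  exact (lobattoIIIC4_stab_neg_le hs).trans (inv_le_one_of_one_le₀ (by linarith))

theorem lobattoIIIC4_c_mem_Icc (i : Fin 4) : lobattoIIIC4.c i ∈ Set.Icc (0 : ℝ) 1 := by
  have h5 : √5 ≤ 5 := Real.sqrt_le_iff.2 (by norm_num)
  have h5' : 0 ≤ √5 := Real.sqrt_nonneg 5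
  fin_cases i <;> simp [lobattoIIIC4] <;> constructor <;> linarith

theorem lp_sum_apply {ι α : Type*} (s : Finset ι) (F : ι → lp (fun _ : α => ℝ) 2) (a : α) :
    (∑ i ∈ s, F i) a = ∑ i ∈ s, F i a := by
  rw [lp.coeFn_sum]
  exact Finset.sum_apply a s _

/-- The error recursion in one mode: `x`, `y`, `v` are the components of `U_{k+1}^n`, `U_k^n`,
`u^{nJ}`; `z` and `w` are the fine propagations of `y` and `v`. The source `φ` cancels, and the
weights add up as `g C + C (1 - g) = C`. -/
theorem norm_parareal_update_le {𝕜 H : Type*} [RCLike 𝕜] [NormedAddCommGroup H]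
    [InnerProductSpace 𝕜 H] {x y z v w φ : H} {g q b C : ℝ} (hg : 0 ≤ g)
    (hcontr : |q - g| ≤ C * (1 - g)) (hz : z - w = (q : 𝕜) • (y - v)) (hx : ‖x - v‖ ≤ C * b)
    (hy : ‖y - v‖ ≤ b) :
    ‖(g : 𝕜) • (x + φ) + z - (g : 𝕜) • (y + φ) - w‖ ≤ C * b := by
  have hb : 0 ≤ b := (norm_nonneg _).trans hy
  have key : (g : 𝕜) • (x + φ) + z - (g : 𝕜) • (y + φ) - w =
      (g : 𝕜) • (x - v) + ((q - g : ℝ) : 𝕜) • (y - v) := by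
    rw [RCLike.ofReal_sub, sub_smul, ← hz]
    simp only [smul_add, smul_sub]
    abel
  rw [key]
  refine (norm_add_le _ _).trans ?_
  rw [norm_smul, norm_smul, RCLike.norm_ofReal, RCLike.norm_ofReal, abs_of_nonneg hg]
  have h1 : g * ‖x - v‖ ≤ g * (C * b) := by gcongr
  have h2 : |q - g| * ‖y - v‖ ≤ C * (1 - g) * b :=
    mul_le_mul hcontr hy (norm_nonneg _) ((abs_nonneg _).trans hcontr)
  linarith

section Parareal

variable {𝕜 H : Type*} [RCLike 𝕜] [NormedAddCommGroup H] [InnerProductSpace 𝕜 H] [CompleteSpace H]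

theorem fineSteps_add {m : ℕ} (B : ButcherTableau m) (A : H →ₗ.[𝕜] H) (f : ℝ → H) (τ t : ℝ) (v : H)
    (i j : ℕ) :
    fineSteps B A f τ t v (i + j) = fineSteps B A f τ (t + i * τ) (fineSteps B A f τ t v i) j := by
  induction j with
  | zero => rfl
  | succ j ih =>
    rw [← add_assoc, fineSteps, fineSteps, ih]
    congr 1
    push_cast
    ring

namespace IsPosDefSelfAdjointCompactInverse

variable {A : H →ₗ.[𝕜] H}

theorem eigenProj_fineProp (hA : IsPosDefSelfAdjointCompactInverse A) (f : ℝ → H) {τ : ℝ}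
    (hτ : 0 < τ) (t : ℝ) (v : H) (μ : ℝ) :
    eigenProj A μ (fineProp lobattoIIIC4 A f τ t v) =
      (lobattoIIIC4.stab (-(τ * μ)) : 𝕜) • eigenProj A μ v +
        (τ : 𝕜) • ∑ i, (lobattoIIIC4.src i (-(τ * μ)) : 𝕜) •
          eigenProj A μ (f (t + lobattoIIIC4.c i * τ)) := by
  rw [fineProp, map_add, map_smul, map_sum]
  congr 1
  · exact hA.eigenProj_opFun (φ := fun μ => lobattoIIIC4.stab (-(τ * μ)))
      (fun ν hν => abs_lobattoIIIC4_stab_neg_le (by positivity)) v μ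
  · congr 1
    exact Finset.sum_congr rfl fun i _ =>
      hA.eigenProj_opFun (φ := fun μ => lobattoIIIC4.src i (-(τ * μ)))
        (fun ν hν => abs_lobattoIIIC4_src_neg_le (by positivity) i) _ μ

theorem eigenProj_fineSteps_sub (hA : IsPosDefSelfAdjointCompactInverse A) (f : ℝ → H) {τ : ℝ}
    (hτ : 0 < τ) (t : ℝ) (v w : H) (μ : ℝ) (j : ℕ) :
    eigenProj A μ (fineSteps lobattoIIIC4 A f τ t v j) -
        eigenProj A μ (fineSteps lobattoIIIC4 A f τ t w j) =
      ((lobattoIIIC4.stab (-(τ * μ)) ^ j : ℝ) : 𝕜) • (eigenProj A μ v - eigenProj A μ w) := by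
  induction j with
  | zero => simp [fineSteps]
  | succ j ih =>
    rw [fineSteps, fineSteps, hA.eigenProj_fineProp f hτ, hA.eigenProj_fineProp f hτ,
      add_sub_add_right_eq_sub, ← smul_sub, ih, smul_smul, ← RCLike.ofReal_mul, pow_succ']

theorem norm_eigenProj_fineSteps_le (hA : IsPosDefSelfAdjointCompactInverse A) (f : ℝ → H) {τ : ℝ}
    (hτ : 0 < τ) (t : ℝ) (v : H) {μ : ℝ} (hμ : 0 ≤ μ) (j : ℕ) :
    ‖eigenProj A μ (fineSteps lobattoIIIC4 A f τ t v j)‖ ≤ ‖eigenProj A μ v‖ +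
      ∑ l ∈ Finset.range j, τ * ∑ i, ‖eigenProj A μ (f (t + l * τ + lobattoIIIC4.c i * τ))‖ := by
  induction j with
  | zero => simp [fineSteps]
  | succ j ih =>
    rw [fineSteps, hA.eigenProj_fineProp f hτ, Finset.sum_range_succ, ← add_assoc]
    refine (norm_add_le _ _).trans (add_le_add (le_trans ?_ ih) ?_)
    · rw [norm_smul, RCLike.norm_ofReal]
      exact mul_le_of_le_one_left (norm_nonneg _) (abs_lobattoIIIC4_stab_neg_le (by positivity))
    · rw [norm_smul, RCLike.norm_ofReal, abs_of_pos hτ]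
      gcongr
      refine (norm_sum_le _ _).trans (Finset.sum_le_sum fun i _ => ?_)
      rw [norm_smul, RCLike.norm_ofReal]
      exact mul_le_of_le_one_left (norm_nonneg _) (abs_lobattoIIIC4_src_neg_le (by positivity) i)

theorem eigenProj_coarseProp (hA : IsPosDefSelfAdjointCompactInverse A) (f : ℝ → H) {τ : ℝ}
    (hτ : 0 < τ) (t : ℝ) (v : H) {μ : ℝ} (hμ : 0 ≤ μ) :
    eigenProj A μ (coarseProp A f τ t v) =
      (((1 + τ * μ)⁻¹ : ℝ) : 𝕜) • (eigenProj A μ v + (τ : 𝕜) • eigenProj A μ (f t)) := by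
  rw [coarseProp, hA.eigenProj_resolventStep hτ _ hμ, map_add, map_smul]

theorem norm_eigenProj_pararealInit_le (hA : IsPosDefSelfAdjointCompactInverse A) (f : ℝ → H)
    (u0 : H) {τ : ℝ} (hτ : 0 < τ) {μ : ℝ} (hμ : 0 ≤ μ) (n : ℕ) :
    ‖eigenProj A μ (pararealInit A f u0 τ n)‖ ≤
      ‖eigenProj A μ u0‖ + ∑ l ∈ Finset.range n, τ * ‖eigenProj A μ (f (l * τ))‖ := by
  induction n with
  | zero => simp [pararealInit]
  | succ n ih =>
    have hg : |(1 + τ * μ)⁻¹| ≤ 1 := by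
      rw [abs_of_nonneg (by positivity)]
      exact inv_le_one_of_one_le₀ (by nlinarith [mul_nonneg hτ.le hμ])
    rw [pararealInit, hA.eigenProj_coarseProp f hτ _ _ hμ, Finset.sum_range_succ, ← add_assoc,
      norm_smul, RCLike.norm_ofReal]
    refine (mul_le_of_le_one_left (norm_nonneg _) hg).trans
      ((norm_add_le _ _).trans (add_le_add ih ?_))
    rw [norm_smul, RCLike.norm_ofReal, abs_of_pos hτ]

/-- Each sweep of the parareal iteration contracts the error in each spectral component. -/
theorem norm_eigenProj_parareal_sub_le (hA : IsPosDefSelfAdjointCompactInverse A) (f : ℝ → H)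
    (u0 : H) {τ : ℝ} (hτ : 0 < τ) {J : ℕ} (hJ : 0 < J) {μ : ℝ} (hμ : 0 ≤ μ) {N : ℕ} {b : ℝ}
    (hb0 : 0 ≤ b)
    (hb : ∀ n ≤ N, ‖eigenProj A μ (pararealInit A f u0 (J * τ) n) -
      eigenProj A μ (timeStepping lobattoIIIC4 A f u0 τ (n * J))‖ ≤ b) (k : ℕ) :
    ∀ n ≤ N, ‖eigenProj A μ (parareal lobattoIIIC4 A f u0 τ J k n) -
      eigenProj A μ (timeStepping lobattoIIIC4 A f u0 τ (n * J))‖ ≤ 0.31 ^ k * b := by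
  have hτJ : 0 < J * τ := by positivity
  induction k with
  | zero => simpa [parareal] using hb
  | succ k ih =>
    -- Inner induction on `n`: the new sweep also enters its own right-hand side, through the coarse
    -- step from the previous time point. At `n = 0` all iterates are exact.
    intro n
    induction n with
    | zero =>
      intro _
      have : timeStepping lobattoIIIC4 A f u0 τ (0 * J) = u0 := by rw [zero_mul]; rfl
      rw [this, parareal, pararealSweep, sub_self, norm_zero]
      positivity
    | succ n ihn =>
      intro hn
      have h1 := ihn (by omega)
      have h2 := ih n (by omega)
      have hstep : timeStepping lobattoIIIC4 A f u0 τ ((n + 1) * J) =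
          fineSteps lobattoIIIC4 A f τ (n * (J * τ))
            (timeStepping lobattoIIIC4 A f u0 τ (n * J)) J := by
        rw [timeStepping, add_mul, one_mul, fineSteps_add]
        congr 1
        push_cast
        ring
      have hsub := hA.eigenProj_fineSteps_sub f hτ (n * (J * τ))
        (parareal lobattoIIIC4 A f u0 τ J k n) (timeStepping lobattoIIIC4 A f u0 τ (n * J)) μ J
      have hcontr := abs_stab_pow_sub_le (s := τ * μ) (by positivity) J
      rw [← mul_assoc] at hcontr
      rw [parareal] at h1 ⊢
      rw [hstep, pararealSweep, map_sub, map_add, hA.eigenProj_coarseProp f hτJ _ _ hμ,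
        hA.eigenProj_coarseProp f hτJ _ _ hμ]
      set g : ℝ := (1 + J * τ * μ)⁻¹
      set q : ℝ := lobattoIIIC4.stab (-(τ * μ)) ^ J
      have hg : 0 ≤ g := by positivity
      rw [pow_succ', mul_assoc] at h1 ⊢
      exact norm_parareal_update_le hg hcontr hsub h1 h2

end IsPosDefSelfAdjointCompactInverse

/-! ### Summation over the modes. -/

/-- Linear convergence of the parareal iteration, with a constant independent of the operator and
of the discretization. -/
theorem norm_parareal_sub_le {A : H →ₗ.[𝕜] H} (hA : IsPosDefSelfAdjointCompactInverse A)
    (f : ℝ → H) (u0 : H) {T R M : ℝ} (hu0 : ‖u0‖ ≤ R)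
    (hf : ∀ t ∈ Set.Icc 0 T, ‖f t‖ ≤ M) {τ : ℝ} (hτ : 0 < τ) {J N : ℕ} (hJ : 0 < J)
    (hT : N * (J * τ) = T) (k : ℕ) {n : ℕ} (hn : n ≤ N) :
    ‖parareal lobattoIIIC4 A f u0 τ J k n - timeStepping lobattoIIIC4 A f u0 τ (n * J)‖ ≤
      (2 * R + 5 * (T * M)) * 0.31 ^ k := by
  choose V hV hVμ using hA.exists_lp_norm_eigenProj
  have hτJ : 0 < J * τ := by positivity
  -- `E` is an `ℓ²` vector whose entries dominate the initial error mode by mode: `V u0 + E₁` bounds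
  -- the coarse initial guess and `V u0 + E₂` the fine solution.
  set E₁ := ∑ l ∈ Finset.range N, (J * τ) • V (f (l * (J * τ)))
  set E₂ := ∑ l ∈ Finset.range (N * J), τ • ∑ i, V (f (0 + l * τ + lobattoIIIC4.c i * τ))
  set E := V u0 + E₁ + (V u0 + E₂)
  have hE₁ : ∀ μ, E₁ μ = ∑ l ∈ Finset.range N, (J * τ) * ‖eigenProj A μ (f (l * (J * τ)))‖ := by
    intro μ
    simp only [E₁, lp_sum_apply, lp.coeFn_smul, Pi.smul_apply, smul_eq_mul, hVμ]
  have hE₂ : ∀ μ, E₂ μ = ∑ l ∈ Finset.range (N * J),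
      τ * ∑ i, ‖eigenProj A μ (f (0 + l * τ + lobattoIIIC4.c i * τ))‖ := by
    intro μ
    simp only [E₂, lp_sum_apply, lp.coeFn_smul, Pi.smul_apply, smul_eq_mul, hVμ]
  have hEμ : ∀ μ, E μ = ‖eigenProj A μ u0‖ + E₁ μ + (‖eigenProj A μ u0‖ + E₂ μ) := by
    intro μ
    simp [E, hVμ]
  -- The `5` is one `T M` from the coarse sources and four from the fine stages, each weighted by
  -- `|pᵢ| ≤ 1`.
  have hEnorm : ‖E‖ ≤ 2 * R + 5 * (T * M) := by
    have h1 : ‖E₁‖ ≤ T * M := by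
      refine (norm_sum_le_of_le _ (n := fun _ => J * τ * M) fun l hl => ?_).trans_eq ?_
      · rw [norm_smul, hV, Real.norm_of_nonneg hτJ.le]
        gcongr
        refine hf _ ⟨by positivity, ?_⟩
        rw [← hT]
        gcongr
        exact (Finset.mem_range.1 hl).le
      · rw [Finset.sum_const, Finset.card_range, nsmul_eq_mul, ← mul_assoc, hT]
    have h2 : ‖E₂‖ ≤ 4 * (T * M) := by
      refine (norm_sum_le_of_le _ (n := fun _ => τ * (4 * M)) fun l hl => ?_).trans_eq ?_
      · rw [norm_smul, Real.norm_of_nonneg hτ.le]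
        gcongr
        refine (norm_sum_le_of_le _ (n := fun _ => M) fun i _ => ?_).trans_eq (by simp)
        rw [hV]
        obtain ⟨hc0, hc1⟩ := lobattoIIIC4_c_mem_Icc i
        refine hf _ ⟨by positivity, ?_⟩
        have hl' : (l : ℝ) + 1 ≤ N * J := by exact_mod_cast Finset.mem_range.1 hl
        calc 0 + l * τ + lobattoIIIC4.c i * τ ≤ 0 + l * τ + 1 * τ := by gcongr
          _ = (l + 1) * τ := by ring
          _ ≤ N * J * τ := by gcongr
          _ = T := by rw [← hT, mul_assoc]
      · rw [Finset.sum_const, Finset.card_range, nsmul_eq_mul, ← hT]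
        push_cast
        ring
    have h3 : ‖V u0‖ ≤ R := by rwa [hV]
    calc ‖E‖ ≤ ‖V u0‖ + ‖E₁‖ + (‖V u0‖ + ‖E₂‖) :=
          (norm_add_le _ _).trans (add_le_add (norm_add_le _ _) (norm_add_le _ _))
      _ ≤ 2 * R + 5 * (T * M) := by linarith
  have hmode : ∀ μ, ‖eigenProj A μ (parareal lobattoIIIC4 A f u0 τ J k n -
      timeStepping lobattoIIIC4 A f u0 τ (n * J))‖ ≤ ((0.31 ^ k : ℝ) • E) μ := by
    intro μ
    have hE0 : 0 ≤ E μ := by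
      rw [hEμ, hE₁, hE₂]
      positivity
    rw [lp.coeFn_smul, Pi.smul_apply, smul_eq_mul]
    -- The scalar estimates need `μ ≥ 0`; negative `μ` carry no spectral component.
    rcases lt_or_ge μ 0 with hμ | hμ
    · rw [hA.eigenProj_of_nonpos hμ.le, norm_zero]
      positivity
    rw [map_sub]
    refine hA.norm_eigenProj_parareal_sub_le f u0 hτ hJ hμ hE0 (fun j hj => ?_) k n hn
    rw [hEμ, hE₁, hE₂]
    refine (norm_sub_le _ _).trans (add_le_add
      ((hA.norm_eigenProj_pararealInit_le f u0 hτJ hμ j).trans ?_)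
      ((hA.norm_eigenProj_fineSteps_le f hτ 0 u0 hμ (j * J)).trans ?_))
    · gcongr
    · gcongr
  refine (hA.norm_le_of_norm_eigenProj_le _ hmode).trans ?_
  rw [norm_smul, Real.norm_of_nonneg (by positivity), mul_comm]
  gcongr

end Parareal

end

theorem proposition4p4 (𝕜 : Type*) [RCLike 𝕜] :
    (∀ s : ℝ, 0 ≤ s → lobattoIIIC4.stab (-s) =
      (12 * s ^ 2 - 120 * s + 360) / (s ^ 4 + 12 * s ^ 3 + 72 * s ^ 2 + 240 * s + 360)) ∧
    ∀ T R M : ℝ, 0 < T → ∃ c : ℝ,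
      ∀ (H : Type*) [NormedAddCommGroup H] [InnerProductSpace 𝕜 H] [CompleteSpace H]
        (A : H →ₗ.[𝕜] H), IsPosDefSelfAdjointCompactInverse A →
      ∀ (u0 : H) (f : ℝ → H), ContinuousOn f (Set.Icc 0 T) → ‖u0‖ ≤ R →
        (∀ t ∈ Set.Icc 0 T, ‖f t‖ ≤ M) →
      ∀ J Nc : ℕ, 2 ≤ J → 1 ≤ Nc → ∀ k n : ℕ, 1 ≤ n → n ≤ Nc →
        ‖parareal lobattoIIIC4 A f u0 (T / (J * Nc)) J k n
            - timeStepping lobattoIIIC4 A f u0 (T / (J * Nc)) (n * J)‖ ≤ c * 0.31 ^ k := by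
  refine ⟨fun s hs => lobattoIIIC4_stab_neg hs, fun T R M hT => ⟨2 * R + 5 * (T * M), ?_⟩⟩
  intro H _ _ _ A hA u0 f _ hu0 hf J Nc hJ hNc k n _ hn
  have hJ' : (0 : ℝ) < J := by exact_mod_cast (by omega : 0 < J)
  have hN' : (0 : ℝ) < Nc := by exact_mod_cast hNc
  exact norm_parareal_sub_le hA f u0 hu0 hf (by positivity) (by omega) (by field_simp) k hn
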